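/- Let $A\in C^\infty(\mathbb R;\mathbb C^{m\times m})$ have a full asymptotic expansion $A(t)\sim A_0+t^{-1}A_1+t^{-2}A_2+\cdots$ as $t\to\infty$, i.e. $A(t)-\sum_{k\le N}t^{-k}A_k=\mathcal O(t^{-N-1})$ for every $N$, and assume that every derivative of $A$ also has a full asymptotic expansion in powers of $t^{-1}$. Assume that $A_0$ has $m$ distinct eigenvalues and is skew, i.e. $A_0^*=-A_0$. Call a pair $(M,\Lambda)$ of smooth functions $[0,\infty)\to\mathbb C^{m\times m}$ a *diagonalisation* if $M(t)$ is invertible for every $t\ge 0$, $M$ and $M^{-1}$ are bounded on $[0,\infty)$, $\Lambda(t)$ is diagonal for every $t\ge0$, $M$ and $\Lambda$ have full asymptotic expansions in powers of $t^{-1}$ as $t\to\infty$, and $$\Big(\frac{\mathrm d}{\mathrm dt}-A(t)\Big)M(t)=M(t)\Big(\frac{\mathrm d}{\mathrm dt}-\Lambda(t)\Big)\quad\mathrm{mod}\ \bigcap_N\mathcal O(t^{-N}),$$ that is, $\dot M(t)-A(t)M(t)+M(t)\Lambda(t)=\mathcal O(t^{-N})$ as $t\to\infty$ for every $N$. Then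 a diagonalisation exists. Moreover, for every diagonalisation $(M,\Lambda)$ there are a matrix function $Q(t)$, bounded on $[0,\infty)$, and an invertible matrix $Q(\infty)$ with $Q(t)-Q(\infty)=\mathcal O(t^{-N})$ as $t\to\infty$ for every $N$, such that for every $v_0\in\mathbb C^m$ the solution of $\dot v(t)=A(t)v(t)$, $v(0)=v_0$, satisfies $$v(t)=M(t)\exp\Big(\int_0^t\Lambda(s)\,\mathrm ds\Big)Q(t)\,M^{-1}(0)\,v_0,\qquad t\ge 0.$$ -/

import Mathlib

open Set Filter Asymptotics
open scoped Topology ContDiff Matrix Matrix.Norms.Operator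

namespace WKB

/-- Square complex matrices of size `m`. They carry the operator norm induced by the sup norm of
`ℂ^m`; all norms on this finite-dimensional space are equivalent, so nothing below depends on
this choice. -/
abbrev Mat (m : ℕ) : Type := Matrix (Fin m) (Fin m) ℂ

/-- `F(t) ∼ C 0 + t⁻¹ C 1 + t⁻² C 2 + ⋯` as `t → ∞`: for every `N` the difference between `F(t)` and
the partial sum up to the order `N` is `O(t^{-(N+1)})`. -/
def HasAsymptoticExpansion {m : ℕ} (F : ℝ → Mat m) (C : ℕ → Mat m) : Prop :=
  ∀ N : ℕ, (fun t : ℝ => F t - ∑ k ∈ Finset.range (N + 1), (t⁻¹) ^ k • C k)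
    =O[atTop] fun t : ℝ => (t⁻¹) ^ (N + 1)

/-- Membership in `⋂_N O(t^{-N})` as `t → ∞`. -/
def RapidlyDecaying {m : ℕ} (F : ℝ → Mat m) : Prop :=
  ∀ N : ℕ, F =O[atTop] fun t : ℝ => (t⁻¹) ^ N

/-- The matrix has `m` distinct eigenvalues. -/
def NonDegenerate {m : ℕ} (B : Mat m) : Prop :=
  ∃ μ : Fin m → ℂ, Function.Injective μ ∧
    ∀ i, Module.End.HasEigenvalue (Matrix.toLin' B) (μ i)

/-- `v` solves `v' = A(t) v` on `[0, ∞)` with `v(0) = v₀` (one-sided derivative at `0`). -/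
def IsSolution {m : ℕ} (A : ℝ → Mat m) (v₀ : Fin m → ℂ) (v : ℝ → Fin m → ℂ) : Prop :=
  v 0 = v₀ ∧ ∀ t : ℝ, 0 ≤ t → HasDerivWithinAt v (A t *ᵥ v t) (Ici 0) t

/-- The operator `(d/dt - A(t)) M(t) - M(t) (d/dt - Λ(t))`; it is the multiplication by this matrix,
see `remainder_mulVec`. -/
noncomputable def remainder {m : ℕ} (A M Λ : ℝ → Mat m) (t : ℝ) : Mat m :=
  deriv M t - A t * M t + M t * Λ t

theorem remainder_mulVec {m : ℕ} (A M Λ : ℝ → Mat m) (w : ℝ → Fin m → ℂ) (t : ℝ)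
    (hM : DifferentiableAt ℝ M t) (hw : DifferentiableAt ℝ w t) :
    (deriv (fun s => M s *ᵥ w s) t - A t *ᵥ (M t *ᵥ w t))
      - M t *ᵥ (deriv w t - Λ t *ᵥ w t) = remainder A M Λ t *ᵥ w t := by
  have hMe : ∀ i j, HasDerivAt (fun s => M s i j) (deriv M t i j) t := by
    intro i j
    let L : Mat m →ₗ[ℝ] ℂ := Matrix.entryLinearMap ℝ ℂ i j
    exact ((LinearMap.toContinuousLinearMap L).hasFDerivAt.comp_hasDerivAt t hM.hasDerivAt)
  have hwe : ∀ j, HasDerivAt (fun s => w s j) (deriv w t j) t :=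
    hasDerivAt_pi.1 hw.hasDerivAt
  have h : HasDerivAt (fun s => M s *ᵥ w s) (deriv M t *ᵥ w t + M t *ᵥ deriv w t) t := by
    rw [hasDerivAt_pi]
    intro i
    have := HasDerivAt.fun_sum (u := Finset.univ) fun j _ => (hMe i j).mul (hwe j)
    simpa [Matrix.mulVec, dotProduct, Finset.sum_add_distrib] using this
  rw [h.deriv]
  simp only [remainder, Matrix.add_mulVec, Matrix.sub_mulVec, Matrix.mulVec_sub,
    Matrix.mulVec_mulVec]
  abel

/-- `M` and `Λ` diagonalise the operator `d/dt - A(t)` on `[0, ∞)` modulo rapidly decaying terms. -/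
structure IsDiagonalisation {m : ℕ} (A M Λ : ℝ → Mat m) : Prop where
  smooth_M : ContDiffOn ℝ ∞ M (Ici 0)
  smooth_Λ : ContDiffOn ℝ ∞ Λ (Ici 0)
  bounded_M : ∃ C : ℝ, ∀ t : ℝ, 0 ≤ t → ‖M t‖ ≤ C
  invertible_M : ∀ t : ℝ, 0 ≤ t → IsUnit (M t)
  bounded_inv_M : ∃ C : ℝ, ∀ t : ℝ, 0 ≤ t → ‖(M t)⁻¹‖ ≤ C
  diagonal_Λ : ∀ t : ℝ, 0 ≤ t → (Λ t).IsDiag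
  expansion_M : ∃ C : ℕ → Mat m, HasAsymptoticExpansion M C
  expansion_Λ : ∃ C : ℕ → Mat m, HasAsymptoticExpansion Λ C
  rapidlyDecaying_remainder : RapidlyDecaying (remainder A M Λ)

end WKB

/-!
The proof has two independent halves.

*Existence.* Insert formal series `M ∼ ∑ t^{-n} Mₙ` and `Λ ∼ ∑ t^{-n} Λₙ` into
`M' - A M + M Λ = 0`. The order zero says that `M₀` diagonalises `A₀`, and the order `n ≥ 1` reads
`A₀ Mₙ - Mₙ Λ₀ - M₀ Λₙ = Sₙ` with `Sₙ` known from the lower orders. As `A₀` has distinct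
eigenvalues, the commutator with `Λ₀` is invertible on off-diagonal matrices in the eigenbasis of
`A₀`, and `Λₙ` absorbs the diagonal part there
(`exists_homological_solution`, `exists_formal_diagonalisation`). Borel summation at
infinity turns the formal series into smooth functions. For `Λ` no derivative enters the equation,
and a cut-off sum is enough; for `M` the derived series is summed and then integrated, which makes
the derivative of `M` have the right expansion without further estimates
(`exists_contDiff_hasAsymptoticExpansion_deriv`). Replacing `M` by the constant `M₀` away from
infinity keeps it close to `M₀`, hence invertible for all times.

*Solutions.* Let `R = M' - A M + M Λ`, `E(t) = exp(∫₀ᵗ Λ)`, and let `Φ` be the fundamental matrix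
with inverse `Ψ`. Then `Y = M(0)⁻¹ Ψ M E` satisfies `Y' = Y b` with `b = E⁻¹ M⁻¹ R E`, and
`Q = Y⁻¹` satisfies `Q' = -b Q`. The point is that `b` decays rapidly. The leading coefficient of
`Λ` is similar to `A₀`, because the derivative of `M` tends to zero; being similar to a skew matrix,
it is imaginary. So the real parts of the entries of `Λ` are `O(t⁻¹)`, and `E` and `E⁻¹` grow at
most polynomially (`IsDiagonalisation.re_isBigO`, `exists_cexp_isBigO_pow`). By Grönwall `Y` and `Q`
are bounded, so `Q'` decays rapidly and `Q` converges faster than any power; the limit is invertible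
because the inverses `Y` of the matrices `Q` are bounded.
-/

namespace WKB

/-! ### Linear differential equations and growth at infinity -/

section ODE

variable {E : Type*} [NormedAddCommGroup E] [NormedSpace ℝ E]

/-- The `n`-th term of the Dyson series of `u' = L(t) u`, `u(0) = x₀`: the `n`-fold iterate of
`g ↦ ∫₀ᵗ L(s) g(s) ds` applied to the constant `x₀`. -/
noncomputable def dysonTerm (L : ℝ → E →L[ℝ] E) (x₀ : E) : ℕ → ℝ → E
  | 0 => fun _ => x₀
  | n + 1 => fun t => ∫ s in (0 : ℝ)..t, L s (dysonTerm L x₀ n s)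

theorem continuous_dysonTerm {L : ℝ → E →L[ℝ] E} (hL : Continuous L) (x₀ : E) (n : ℕ) :
    Continuous (dysonTerm L x₀ n) := by
  induction n with
  | zero => exact continuous_const
  | succ n ih =>
    have h : Continuous fun s => L s (dysonTerm L x₀ n s) := hL.clm_apply ih
    exact intervalIntegral.continuous_primitive (fun a b => h.intervalIntegrable a b) 0

theorem norm_dysonTerm_le {L : ℝ → E →L[ℝ] E} (hL : Continuous L) (x₀ : E) {K T : ℝ}
    (hK : ∀ t, |t| ≤ T → ‖L t‖ ≤ K) (n : ℕ) {t : ℝ} (ht : |t| ≤ T) :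
    ‖dysonTerm L x₀ n t‖ ≤ ‖x₀‖ * (K ^ n * |t| ^ n / n.factorial) := by
  have hK0 : 0 ≤ K := (norm_nonneg _).trans (hK t ht)
  induction n generalizing t with
  | zero => simp [dysonTerm]
  | succ n ih =>
    have hc : Continuous fun s => L s (dysonTerm L x₀ n s) :=
      hL.clm_apply (continuous_dysonTerm hL x₀ n)
    have hbound : ∀ s ∈ uIoc 0 t, ‖L s (dysonTerm L x₀ n s)‖ ≤
        K * ‖x₀‖ * K ^ n / n.factorial * |s - 0| ^ n := by
      intro s hs
      have hst : |s| ≤ T := by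
        refine le_trans ?_ ht
        rcases le_total 0 t with h | h
        · rw [uIoc_of_le h] at hs
          rw [abs_of_nonneg hs.1.le, abs_of_nonneg h]; exact hs.2
        · rw [uIoc_of_ge h] at hs
          rw [abs_of_nonpos hs.2, abs_of_nonpos h]; linarith [hs.1]
      calc ‖L s (dysonTerm L x₀ n s)‖ ≤ ‖L s‖ * ‖dysonTerm L x₀ n s‖ := (L s).le_opNorm _
        _ ≤ K * (‖x₀‖ * (K ^ n * |s| ^ n / n.factorial)) :=
            mul_le_mul (hK s hst) (ih hst) (norm_nonneg _) hK0
        _ = _ := by rw [sub_zero]; ring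
    calc ‖dysonTerm L x₀ (n + 1) t‖
        ≤ ∫ s in uIoc 0 t, ‖L s (dysonTerm L x₀ n s)‖ :=
          intervalIntegral.norm_integral_le_integral_norm_uIoc
      _ ≤ ∫ s in uIoc 0 t, K * ‖x₀‖ * K ^ n / n.factorial * |s - 0| ^ n := by
          refine MeasureTheory.setIntegral_mono_on ?_ ?_ measurableSet_uIoc hbound
          · exact (hc.norm.integrableOn_uIcc).mono_set uIoc_subset_uIcc
          · exact (Continuous.integrableOn_uIcc (by fun_prop)).mono_set uIoc_subset_uIcc
      _ = _ := by
          rw [MeasureTheory.integral_const_mul, integral_pow_abs_sub_uIoc, Nat.factorial_succ]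
          push_cast
          rw [sub_zero]
          field_simp
          ring

/-- Global solvability of linear differential equations with continuous coefficients: the Dyson
series and the series of its derivatives converge uniformly on bounded intervals. -/
theorem exists_hasDerivAt_linear [CompleteSpace E] {L : ℝ → E →L[ℝ] E} (hL : Continuous L)
    (x₀ : E) : ∃ u : ℝ → E, u 0 = x₀ ∧ ∀ t, HasDerivAt u (L t (u t)) t := by
  have hder : ∀ n t, HasDerivAt (dysonTerm L x₀ (n + 1)) (L t (dysonTerm L x₀ n t)) t := by
    intro n t
    have hc : Continuous fun s => L s (dysonTerm L x₀ n s) :=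
      hL.clm_apply (continuous_dysonTerm hL x₀ n)
    exact intervalIntegral.integral_hasDerivAt_right (hc.intervalIntegrable _ _)
      hc.stronglyMeasurable.stronglyMeasurableAtFilter hc.continuousAt
  refine ⟨fun t => x₀ + ∑' n, dysonTerm L x₀ (n + 1) t, ?_, fun t => ?_⟩
  · simp [dysonTerm]
  obtain ⟨T, hT⟩ : ∃ T : ℝ, |t| < T := exists_gt _
  have hT0 : 0 < T := (abs_nonneg t).trans_lt hT
  obtain ⟨K, hK⟩ := (isCompact_Icc (a := -T) (b := T)).exists_bound_of_continuousOn
    hL.continuousOn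
  have hK' : ∀ s, |s| ≤ T → ‖L s‖ ≤ K := fun s hs => hK s (abs_le.1 hs)
  have hK0 : 0 ≤ K := (norm_nonneg _).trans (hK' t hT.le)
  have hb : ∀ n s, |s| ≤ T →
      ‖dysonTerm L x₀ n s‖ ≤ ‖x₀‖ * ((K * T) ^ n / n.factorial) := by
    intro n s hs
    refine (norm_dysonTerm_le hL x₀ hK' n hs).trans ?_
    rw [mul_pow]
    gcongr
  have hsum : Summable fun n : ℕ => ‖x₀‖ * ((K * T) ^ n / n.factorial) :=
    (Real.summable_pow_div_factorial (K * T)).mul_left _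
  have hsumt : Summable fun n => dysonTerm L x₀ n t :=
    Summable.of_norm_bounded hsum fun n => hb n t hT.le
  have key := hasDerivAt_tsum_of_isPreconnected (g := fun n => dysonTerm L x₀ (n + 1))
    (g' := fun n s => L s (dysonTerm L x₀ n s)) (t := Ioo (-T) T) (y₀ := 0) (y := t)
    (hsum.mul_left K) isOpen_Ioo isPreconnected_Ioo (fun n s _ => hder n s)
    (fun n s hs => ((L s).le_opNorm _).trans
      (mul_le_mul (hK' s (abs_lt.2 hs).le) (hb n s (abs_lt.2 hs).le) (norm_nonneg _) hK0))
    ⟨by linarith, hT0⟩ (by simp [dysonTerm, summable_zero]) (abs_lt.1 hT)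
  have hval : x₀ + ∑' n, dysonTerm L x₀ (n + 1) t = ∑' n, dysonTerm L x₀ n t := by
    rw [hsumt.tsum_eq_zero_add]; rfl
  beta_reduce
  rw [hval, (L t).map_tsum hsumt]
  exact key.const_add x₀

theorem inv_pow_isBigO_inv_pow {m n : ℕ} (h : n ≤ m) :
    (fun t : ℝ => (t⁻¹) ^ m) =O[atTop] fun t : ℝ => (t⁻¹) ^ n := by
  refine IsBigO.of_bound 1 ?_
  filter_upwards [eventually_ge_atTop 1] with t ht
  have h0 : 0 ≤ t⁻¹ := by positivity
  rw [one_mul, Real.norm_of_nonneg (by positivity), Real.norm_of_nonneg (by positivity)]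
  exact pow_le_pow_of_le_one h0 (inv_le_one_of_one_le₀ ht) h

theorem tendsto_inv_pow_succ (n : ℕ) :
    Tendsto (fun t : ℝ => (t⁻¹) ^ (n + 1)) atTop (𝓝 0) := by
  simpa using (tendsto_inv_atTop_zero (𝕜 := ℝ)).pow (n + 1)

theorem hasDerivAt_inv_pow_succ (n : ℕ) {t : ℝ} (ht : t ≠ 0) :
    HasDerivAt (fun t : ℝ => (t⁻¹) ^ (n + 1)) (-((n + 1 : ℕ) * (t⁻¹) ^ (n + 2))) t := by
  refine ((hasDerivAt_inv ht).fun_pow (n + 1)).congr_deriv ?_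
  simp only [Nat.add_sub_cancel]
  rw [pow_add t⁻¹ n 2]
  field_simp

/-- A bound on the derivative by an integrable power controls increments near infinity. -/
theorem exists_norm_sub_le_of_deriv_isBigO {f f' : ℝ → E} {n : ℕ}
    (hf : ∀ᶠ t in atTop, HasDerivAt f (f' t) t)
    (hf' : f' =O[atTop] fun t : ℝ => (t⁻¹) ^ (n + 2)) :
    ∃ K T : ℝ, 0 < T ∧ 0 ≤ K ∧
      ∀ s t, T ≤ s → s ≤ t → ‖f t - f s‖ ≤ K * (s⁻¹) ^ (n + 1) := by
  obtain ⟨K, hK0, hK⟩ := hf'.exists_nonneg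
  obtain ⟨T, hT⟩ := eventually_atTop.1 (hf.and (hK.bound.and (eventually_gt_atTop 0)))
  refine ⟨K, T, (hT T le_rfl).2.2, hK0, fun s t hs hst => ?_⟩
  have hT0 : 0 < T := (hT T le_rfl).2.2
  have hpos : ∀ x ∈ Icc s t, 0 < x := fun x hx => hT0.trans_le (hs.trans hx.1)
  have hd : ∀ x ∈ Icc s t, HasDerivAt (fun x => f x - f s) (f' x) x := fun x hx =>
    (hT x (hs.trans hx.1)).1.sub_const _
  have hB : ∀ x ∈ Icc s t, HasDerivAt (fun x : ℝ => K * ((s⁻¹) ^ (n + 1) - (x⁻¹) ^ (n + 1)))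
      (K * ((n + 1 : ℕ) * (x⁻¹) ^ (n + 2))) x := fun x hx =>
    (((hasDerivAt_inv_pow_succ n (hpos x hx).ne').const_sub _).const_mul K).congr_deriv
      (by ring)
  have key := image_norm_le_of_norm_deriv_right_le_deriv_boundary' (f := fun x => f x - f s)
    (f' := f') (a := s) (b := t) (fun x hx => (hd x hx).continuousAt.continuousWithinAt)
    (fun x hx => (hd x (Ico_subset_Icc_self hx)).hasDerivWithinAt)
    (by simp) (fun x hx => (hB x hx).continuousAt.continuousWithinAt)
    (fun x hx => (hB x (Ico_subset_Icc_self hx)).hasDerivWithinAt)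
    (fun x hx => ?_) (right_mem_Icc.2 hst)
  · refine key.trans (mul_le_mul_of_nonneg_left ?_ hK0)
    have := hpos t (right_mem_Icc.2 hst)
    have : 0 ≤ (t⁻¹) ^ (n + 1) := by positivity
    linarith
  · have hx0 := hpos x (Ico_subset_Icc_self hx)
    refine (hT x (hs.trans hx.1)).2.1.trans (mul_le_mul_of_nonneg_left ?_ hK0)
    rw [Real.norm_of_nonneg (by positivity)]
    refine le_mul_of_one_le_left (by positivity) ?_
    push_cast
    linarith [(Nat.cast_nonneg n : (0 : ℝ) ≤ n)]

theorem exists_tendsto_of_deriv_isBigO [CompleteSpace E] {f f' : ℝ → E} {n : ℕ}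
    (hf : ∀ᶠ t in atTop, HasDerivAt f (f' t) t)
    (hf' : f' =O[atTop] fun t : ℝ => (t⁻¹) ^ (n + 2)) : ∃ l, Tendsto f atTop (𝓝 l) := by
  obtain ⟨K, T, hT0, hK0, hK⟩ := exists_norm_sub_le_of_deriv_isBigO hf hf'
  refine cauchySeq_tendsto_of_complete (u := f) (Metric.cauchySeq_iff'.2 fun ε hε => ?_)
  have hlim : Tendsto (fun s : ℝ => K * (s⁻¹) ^ (n + 1)) atTop (𝓝 0) := by
    simpa using (tendsto_inv_pow_succ n).const_mul K
  obtain ⟨s, hs, hsT⟩ := ((hlim.eventually (gt_mem_nhds hε)).and (eventually_ge_atTop T)).exists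
  exact ⟨s, fun t ht => (dist_eq_norm (f t) (f s) ▸ hK s t hsT ht).trans_lt hs⟩

theorem isBigO_sub_of_tendsto_of_deriv_isBigO {f f' : ℝ → E} {n : ℕ} {l : E}
    (hl : Tendsto f atTop (𝓝 l)) (hf : ∀ᶠ t in atTop, HasDerivAt f (f' t) t)
    (hf' : f' =O[atTop] fun t : ℝ => (t⁻¹) ^ (n + 2)) :
    (fun t => f t - l) =O[atTop] fun t : ℝ => (t⁻¹) ^ (n + 1) := by
  obtain ⟨K, T, hT0, hK0, hK⟩ := exists_norm_sub_le_of_deriv_isBigO hf hf'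
  refine IsBigO.of_bound K ?_
  filter_upwards [eventually_ge_atTop T] with s hs
  have hs0 : 0 < s := hT0.trans_le hs
  rw [Real.norm_of_nonneg (by positivity), norm_sub_rev]
  refine le_of_tendsto ((hl.sub_const (f s)).norm) ?_
  filter_upwards [eventually_ge_atTop s] with t ht using hK s t hs ht

/-- Grönwall's estimate on a half-line: if `‖f'‖ ≤ g ‖f‖` near infinity with `g` integrable there,
then `f` stays bounded. The barrier is `c e^{-2K/t}`, where `g ≤ K t⁻²`. -/
theorem isBigO_one_of_norm_deriv_le {f f' : ℝ → E} {g : ℝ → ℝ}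
    (hf : ∀ᶠ t in atTop, HasDerivAt f (f' t) t) (hg : g =O[atTop] fun t : ℝ => (t⁻¹) ^ 2)
    (hfg : ∀ᶠ t in atTop, ‖f' t‖ ≤ g t * ‖f t‖) :
    f =O[atTop] fun _ => (1 : ℝ) := by
  obtain ⟨K, hK0, hK⟩ := hg.exists_pos
  obtain ⟨T, hT⟩ := eventually_atTop.1
    (hf.and (hfg.and (hK.bound.and (eventually_gt_atTop 0))))
  have hT0 : 0 < T := (hT T le_rfl).2.2.2
  -- The rate `2 K` in place of `K` makes the barrier grow strictly faster than `‖f‖`, as required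
  -- by the comparison lemma; the `+ 1` keeps it positive.
  obtain ⟨c, hc⟩ : ∃ c, (‖f T‖ + 1) / Real.exp (-(2 * K) * T⁻¹) = c := ⟨_, rfl⟩
  have hc0 : 0 < c := by rw [← hc]; positivity
  refine IsBigO.of_bound c ?_
  filter_upwards [eventually_ge_atTop T] with t ht
  have hpos : ∀ x ∈ Icc T t, 0 < x := fun x hx => hT0.trans_le hx.1
  have hB : ∀ x ∈ Icc T t, HasDerivAt (fun x : ℝ => c * Real.exp (-(2 * K) * x⁻¹))
      (c * (Real.exp (-(2 * K) * x⁻¹) * (2 * K * (x⁻¹) ^ 2))) x := fun x hx =>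
    ((((hasDerivAt_inv (hpos x hx).ne').const_mul (-(2 * K))).exp).const_mul c).congr_deriv
      (by field_simp)
  have key := image_norm_le_of_norm_deriv_right_lt_deriv_boundary' (f := f)
    (f' := f') (a := T) (b := t)
    (fun x hx => (hT x hx.1).1.continuousAt.continuousWithinAt)
    (fun x hx => (hT x hx.1).1.hasDerivWithinAt)
    (B := fun x : ℝ => c * Real.exp (-(2 * K) * x⁻¹))
    (by rw [← hc, div_mul_cancel₀ _ (Real.exp_pos _).ne']; linarith)
    (fun x hx => (hB x hx).continuousAt.continuousWithinAt)
    (fun x hx => (hB x (Ico_subset_Icc_self hx)).hasDerivWithinAt)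
    (fun x hx hfx => ?_) (right_mem_Icc.2 ht)
  · rw [norm_one, mul_one]
    refine key.trans (mul_le_of_le_one_right hc0.le (Real.exp_le_one_iff.2 ?_))
    have := hpos t (right_mem_Icc.2 ht)
    have : 0 ≤ K * t⁻¹ := by positivity
    linarith
  · have hx0 := hpos x (Ico_subset_Icc_self hx)
    have hgx : g x ≤ K * (x⁻¹) ^ 2 := by
      have := (hT x hx.1).2.2.1
      rw [Real.norm_of_nonneg (by positivity : 0 ≤ (x⁻¹) ^ 2)] at this
      exact (le_abs_self _).trans this
    calc ‖f' x‖ ≤ g x * ‖f x‖ := (hT x hx.1).2.1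
      _ ≤ K * (x⁻¹) ^ 2 * ‖f x‖ := by gcongr
      _ = K * (x⁻¹) ^ 2 * (c * Real.exp (-(2 * K) * x⁻¹)) := by rw [hfx]
      _ < _ := by
        have : 0 < K * (x⁻¹) ^ 2 * (c * Real.exp (-(2 * K) * x⁻¹)) := by positivity
        linarith

end ODE

theorem exists_norm_le_of_continuousOn_of_tendsto {E : Type*} [NormedAddCommGroup E]
    {f : ℝ → E} {l : E} (hf : ContinuousOn f (Ici 0)) (hl : Tendsto f atTop (𝓝 l)) :
    ∃ K : ℝ, ∀ t : ℝ, 0 ≤ t → ‖f t‖ ≤ K := by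
  obtain ⟨T, hT⟩ := eventually_atTop.1
    (hl.norm.eventually (eventually_le_nhds (lt_add_one ‖l‖)))
  obtain ⟨K, hK⟩ := (isCompact_Icc (a := 0) (b := T)).exists_bound_of_continuousOn
    (hf.mono Icc_subset_Ici_self)
  refine ⟨max K (‖l‖ + 1), fun t ht => ?_⟩
  rcases le_total t T with h | h
  · exact (hK t ⟨ht, h⟩).trans (le_max_left _ _)
  · exact (hT t h).trans (le_max_right _ _)

/-! ### Algebra of asymptotic expansions -/

section Expansions

variable {m : ℕ} {F G : ℝ → Mat m} {C D : ℕ → Mat m}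

theorem inv_pow_smul_isBigO (N : ℕ) (B : Mat m) :
    (fun t : ℝ => (t⁻¹) ^ N • B) =O[atTop] fun t : ℝ => (t⁻¹) ^ N := by
  simpa using (isBigO_refl (fun t : ℝ => (t⁻¹) ^ N) atTop).smul
    (isBigO_refl (fun _ : ℝ => B) atTop |>.trans (isBigO_const_const B (one_ne_zero (α := ℝ)) _))

/-- It is enough to control the remainder after order `N` by `t^{-N}` for every `N`: one more term
of the expansion recovers the missing power. -/
theorem hasAsymptoticExpansion_of_isBigO
    (h : ∀ N : ℕ, (fun t : ℝ => F t - ∑ k ∈ Finset.range (N + 1), (t⁻¹) ^ k • C k)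
      =O[atTop] fun t : ℝ => (t⁻¹) ^ N) : HasAsymptoticExpansion F C := by
  intro N
  refine ((h (N + 1)).add (inv_pow_smul_isBigO (N + 1) (C (N + 1)))).congr_left fun t => ?_
  rw [Finset.sum_range_succ _ (N + 1)]
  abel

theorem HasAsymptoticExpansion.isBigO_range (h : HasAsymptoticExpansion F C) (N : ℕ) :
    (fun t : ℝ => F t - ∑ k ∈ Finset.range N, (t⁻¹) ^ k • C k)
      =O[atTop] fun t : ℝ => (t⁻¹) ^ N := by
  refine (((h N).trans (inv_pow_isBigO_inv_pow N.le_succ)).add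
    (inv_pow_smul_isBigO N (C N))).congr_left fun t => ?_
  rw [Finset.sum_range_succ]
  abel

theorem hasAsymptoticExpansion_of_isBigO_range
    (h : ∀ N : ℕ, (fun t : ℝ => F t - ∑ k ∈ Finset.range N, (t⁻¹) ^ k • C k)
      =O[atTop] fun t : ℝ => (t⁻¹) ^ N) : HasAsymptoticExpansion F C :=
  fun N => h (N + 1)

theorem HasAsymptoticExpansion.isBigO_one (h : HasAsymptoticExpansion F C) :
    F =O[atTop] fun _ => (1 : ℝ) := by
  simpa using h.isBigO_range 0

theorem HasAsymptoticExpansion.isBigO_sub (h : HasAsymptoticExpansion F C) :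
    (fun t => F t - C 0) =O[atTop] fun t : ℝ => t⁻¹ := by
  simpa using h 0

theorem HasAsymptoticExpansion.tendsto (h : HasAsymptoticExpansion F C) :
    Tendsto F atTop (𝓝 (C 0)) := by
  have h0 := (h.isBigO_sub.trans_tendsto tendsto_inv_atTop_zero).add_const (C 0)
  simp only [sub_add_cancel, zero_add] at h0
  exact h0

theorem HasAsymptoticExpansion.congr' (h : HasAsymptoticExpansion F C) (hFG : F =ᶠ[atTop] G) :
    HasAsymptoticExpansion G C := fun N =>
  (h N).congr' (by filter_upwards [hFG] with t ht; rw [ht]) EventuallyEq.rfl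

theorem HasAsymptoticExpansion.add (hF : HasAsymptoticExpansion F C)
    (hG : HasAsymptoticExpansion G D) :
    HasAsymptoticExpansion (fun t => F t + G t) fun n => C n + D n := fun N =>
  ((hF N).add (hG N)).congr_left fun t => by
    simp only [smul_add, Finset.sum_add_distrib]; abel

theorem HasAsymptoticExpansion.sub (hF : HasAsymptoticExpansion F C)
    (hG : HasAsymptoticExpansion G D) :
    HasAsymptoticExpansion (fun t => F t - G t) fun n => C n - D n := fun N =>
  ((hF N).sub (hG N)).congr_left fun t => by
    simp only [smul_sub, Finset.sum_sub_distrib]; abel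

theorem HasAsymptoticExpansion.rapidlyDecaying (h : HasAsymptoticExpansion F fun _ => 0) :
    RapidlyDecaying F := fun N => by
  simpa using h.isBigO_range N

/-- Splitting off the leading term: `t (F(t) - C 0)` has the shifted expansion. -/
theorem HasAsymptoticExpansion.tail (h : HasAsymptoticExpansion F C) :
    HasAsymptoticExpansion (fun t => t • (F t - C 0)) fun n => C (n + 1) := by
  refine hasAsymptoticExpansion_of_isBigO_range fun N => ?_
  refine ((isBigO_refl (fun t : ℝ => t) atTop).smul (h N)).congr' ?_ ?_
  · filter_upwards [eventually_ne_atTop 0] with t ht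
    rw [Finset.sum_range_succ', pow_zero, one_smul, ← sub_sub, sub_right_comm, smul_sub,
      Finset.smul_sum]
    congr 1
    refine Finset.sum_congr rfl fun k _ => ?_
    rw [smul_smul]
    rw [pow_succ', mul_inv_cancel_left₀ ht]
  · filter_upwards [eventually_ne_atTop 0] with t ht
    rw [smul_eq_mul, pow_succ, mul_comm, mul_assoc, inv_mul_cancel₀ ht, mul_one]

/-- The Cauchy product of two expansions. With `F = C 0 + t⁻¹ F₁` one has `FG = C 0 G + t⁻¹ F₁ G`,
which gives an induction on the order of the remainder. -/
theorem HasAsymptoticExpansion.mul (hF : HasAsymptoticExpansion F C)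
    (hG : HasAsymptoticExpansion G D) :
    HasAsymptoticExpansion (fun t => F t * G t)
      fun n => ∑ p ∈ Finset.HasAntidiagonal.antidiagonal n, C p.1 * D p.2 := by
  refine hasAsymptoticExpansion_of_isBigO_range fun N => ?_
  induction N generalizing F C with
  | zero => simpa using hF.isBigO_one.mul hG.isBigO_one
  | succ N ih =>
    have h1 : (fun t => C 0 * (G t - ∑ k ∈ Finset.range (N + 1), (t⁻¹) ^ k • D k))
        =O[atTop] fun t : ℝ => (t⁻¹) ^ (N + 1) := by
      simpa using (isBigO_refl (fun _ : ℝ => C 0) atTop |>.trans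
        (isBigO_const_const (C 0) (one_ne_zero (α := ℝ)) _)).mul (hG N)
    have h2 := (isBigO_refl (fun t : ℝ => t⁻¹) atTop).smul (ih hF.tail)
    refine (h1.add (h2.congr_right (g₂ := fun t : ℝ => (t⁻¹) ^ (N + 1)) fun t => by
      rw [smul_eq_mul, pow_succ']) ).congr' ?_ EventuallyEq.rfl
    filter_upwards [eventually_ne_atTop 0] with t ht
    have hFt : F t * G t = C 0 * G t + t⁻¹ • ((t • (F t - C 0)) * G t) := by
      rw [smul_mul_assoc, smul_smul, inv_mul_cancel₀ ht, one_smul, sub_mul]; abel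
    rw [hFt, Finset.sum_range_succ', Finset.sum_range_succ' _ N]
    simp only [Finset.Nat.sum_antidiagonal_succ, smul_add, Finset.sum_add_distrib]
    rw [mul_sub, mul_add, Finset.mul_sum, smul_sub, Finset.smul_sum]
    simp only [Finset.Nat.antidiagonal_zero, Finset.sum_singleton, mul_smul_comm, smul_smul,
      pow_succ']
    abel

end Expansions

/-! ### Borel summation at infinity -/

section Borel

variable {m : ℕ}

/-- The point beyond which the `k`-th term of the Borel sum is switched on. It exceeds `k`, so that
the sum is locally finite, and `2 ^ k * ‖C k‖`, so that the sum converges geometrically. -/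
noncomputable def borelThreshold (C : ℕ → Mat m) (k : ℕ) : ℝ := k + 1 + 2 ^ k * ‖C k‖

/-- The `k`-th term `t^{-k} C k` of an expansion, cut off smoothly to the left of
`borelThreshold C k`. -/
noncomputable def borelTerm (C : ℕ → Mat m) (k : ℕ) (t : ℝ) : Mat m :=
  (Real.smoothTransition (t - borelThreshold C k) * (t⁻¹) ^ k) • C k

/-- A function with the prescribed asymptotic expansion. -/
noncomputable def borelSum (C : ℕ → Mat m) (t : ℝ) : Mat m := ∑' k, borelTerm C k t

theorem le_borelThreshold (C : ℕ → Mat m) (k : ℕ) : (k : ℝ) + 1 ≤ borelThreshold C k :=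
  le_add_of_nonneg_right (by positivity)

theorem borelTerm_eq_zero {C : ℕ → Mat m} {k : ℕ} {t : ℝ} (h : t ≤ borelThreshold C k) :
    borelTerm C k t = 0 := by
  rw [borelTerm, Real.smoothTransition.zero_of_nonpos (sub_nonpos.2 h), zero_mul, zero_smul]

theorem contDiff_borelTerm (C : ℕ → Mat m) (k : ℕ) : ContDiff ℝ ∞ (borelTerm C k) := by
  refine contDiff_iff_contDiffAt.2 fun t => ?_
  rcases lt_or_ge t 1 with ht | ht
  · refine (contDiffAt_const (c := (0 : Mat m))).congr_of_eventuallyEq ?_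
    filter_upwards [eventually_lt_nhds ht] with s hs
    refine borelTerm_eq_zero (hs.le.trans (le_trans ?_ (le_borelThreshold C k)))
    simp
  · have h1 : ContDiffAt ℝ ∞ (fun t : ℝ => Real.smoothTransition (t - borelThreshold C k)) t :=
      (Real.smoothTransition.contDiff.comp (contDiff_id.sub contDiff_const)).contDiffAt
    exact (h1.mul ((contDiffAt_inv ℝ (by positivity)).pow k)).smul contDiffAt_const

theorem borelSum_eq_sum {C : ℕ → Mat m} {n : ℕ} {t : ℝ} (h : t ≤ n) :
    borelSum C t = ∑ k ∈ Finset.range n, borelTerm C k t := by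
  refine tsum_eq_sum fun k hk => borelTerm_eq_zero ?_
  have : (n : ℝ) ≤ k := by exact_mod_cast not_lt.1 fun h => hk (Finset.mem_range.2 h)
  linarith [le_borelThreshold C k]

theorem contDiff_borelSum (C : ℕ → Mat m) : ContDiff ℝ ∞ (borelSum C) := by
  refine contDiff_iff_contDiffAt.2 fun t => ?_
  obtain ⟨n, hn⟩ := exists_nat_gt t
  refine (ContDiff.sum fun k _ => contDiff_borelTerm C k : ContDiff ℝ ∞ fun t =>
    ∑ k ∈ Finset.range n, borelTerm C k t).contDiffAt.congr_of_eventuallyEq ?_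
  filter_upwards [eventually_lt_nhds hn] with s hs using borelSum_eq_sum hs.le

theorem isDiag_borelSum {C : ℕ → Mat m} (hC : ∀ k, (C k).IsDiag) (t : ℝ) :
    (borelSum C t).IsDiag := by
  obtain ⟨n, hn⟩ := exists_nat_gt t
  rw [borelSum_eq_sum hn.le]
  intro i j hij
  rw [Matrix.sum_apply]
  refine Finset.sum_eq_zero fun k _ => ?_
  rw [borelTerm, Matrix.smul_apply, hC k hij, smul_zero]

theorem norm_borelTerm_le (C : ℕ → Mat m) (N k : ℕ) {t : ℝ} (ht : 1 ≤ t) :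
    ‖borelTerm C (k + (N + 1)) t‖ ≤ (t⁻¹) ^ N * (1 / 2) ^ k := by
  have ht0 : 0 < t := by positivity
  rcases le_total t (borelThreshold C (k + (N + 1))) with h | h
  · rw [borelTerm_eq_zero h, norm_zero]; positivity
  · have hC : ‖C (k + (N + 1))‖ ≤ t * (1 / 2) ^ k := by
      have h1 : 2 ^ (k + (N + 1)) * ‖C (k + (N + 1))‖ ≤ t :=
        le_trans (le_add_of_nonneg_left (by positivity)) h
      have h2 : (2 : ℝ) ^ k * ‖C (k + (N + 1))‖ ≤ t :=
        le_trans (mul_le_mul_of_nonneg_right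
          (pow_le_pow_right₀ one_le_two (Nat.le_add_right _ _)) (norm_nonneg _)) h1
      rw [one_div, inv_pow, ← div_eq_mul_inv, le_div_iff₀ (by positivity), mul_comm]
      exact h2
    have hinv : t⁻¹ ≤ 1 := inv_le_one_of_one_le₀ ht
    rw [borelTerm, norm_smul, norm_mul, Real.norm_of_nonneg (Real.smoothTransition.nonneg _),
      Real.norm_of_nonneg (by positivity)]
    calc _ ≤ 1 * (t⁻¹) ^ (k + (N + 1)) * (t * (1 / 2) ^ k) := by
          gcongr
          exact Real.smoothTransition.le_one _
      _ = (t⁻¹) ^ k * ((t⁻¹) ^ N * (1 / 2) ^ k) := by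
          rw [pow_add, pow_succ]; field_simp
      _ ≤ 1 * ((t⁻¹) ^ N * (1 / 2) ^ k) := by
          gcongr
          exact pow_le_one₀ (by positivity) hinv
      _ = _ := one_mul _

theorem hasAsymptoticExpansion_borelSum (C : ℕ → Mat m) :
    HasAsymptoticExpansion (borelSum C) C := by
  refine hasAsymptoticExpansion_of_isBigO fun N => IsBigO.of_bound 2 ?_
  have hev : ∀ᶠ t : ℝ in atTop, ∀ k ∈ Finset.range (N + 1), borelThreshold C k + 1 ≤ t :=
    (Filter.eventually_all_finset _).2 fun k _ => eventually_ge_atTop _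
  filter_upwards [hev, eventually_ge_atTop 1] with t ht ht1
  have hfin : Summable fun k => borelTerm C k t := by
    obtain ⟨n, hn⟩ := exists_nat_gt t
    refine summable_of_ne_finset_zero (s := Finset.range n) fun k hk => borelTerm_eq_zero ?_
    have : (n : ℝ) ≤ k := by exact_mod_cast not_lt.1 fun h => hk (Finset.mem_range.2 h)
    linarith [le_borelThreshold C k]
  have hhead : ∑ k ∈ Finset.range (N + 1), (t⁻¹) ^ k • C k =
      ∑ k ∈ Finset.range (N + 1), borelTerm C k t := by
    refine Finset.sum_congr rfl fun k hk => ?_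
    rw [borelTerm, Real.smoothTransition.one_of_one_le (by linarith [ht k hk]), one_mul]
  rw [hhead, borelSum, ← hfin.sum_add_tsum_nat_add (N + 1), add_sub_cancel_left,
    Real.norm_of_nonneg (by positivity), mul_comm]
  exact tsum_of_norm_bounded (hasSum_geometric_two.mul_left _)
    fun k => norm_borelTerm_le C N k ht1

/-- The coefficients of the term-by-term derivative of `∑ t^{-k} C k`. For `n = 0` the truncated
subtraction makes the factor zero, as it should be. -/
noncomputable def derivCoeff (C : ℕ → Mat m) (n : ℕ) : Mat m := -(((n - 1 : ℕ) : ℝ) • C (n - 1))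

theorem hasDerivAt_sum_inv_pow_smul (C : ℕ → Mat m) (N : ℕ) {t : ℝ} (ht : t ≠ 0) :
    HasDerivAt (fun t : ℝ => ∑ k ∈ Finset.range (N + 1), (t⁻¹) ^ k • C k)
      (∑ k ∈ Finset.range (N + 2), (t⁻¹) ^ k • derivCoeff C k) t := by
  have h : ∀ k ∈ Finset.range (N + 1), HasDerivAt (fun t : ℝ => (t⁻¹) ^ k • C k)
      ((t⁻¹) ^ (k + 1) • derivCoeff C (k + 1)) t := by
    intro k _
    rcases k with _ | k
    · refine ((hasDerivAt_const t (C 0)).congr_deriv ?_).congr_of_eventuallyEq ?_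
      · simp [derivCoeff]
      · exact Eventually.of_forall fun s => by simp
    · refine ((hasDerivAt_inv_pow_succ k ht).smul_const (C (k + 1))).congr_deriv ?_
      rw [derivCoeff, Nat.add_sub_cancel, smul_neg, smul_smul, neg_smul, mul_comm]
  refine (HasDerivAt.fun_sum h).congr_deriv ?_
  rw [Finset.sum_range_succ' _ (N + 1)]
  simp [derivCoeff]

/-- Borel's lemma at infinity: every formal series in `t⁻¹` is the expansion of a smooth function,
which may be differentiated term by term. The function is a primitive of the Borel sum of the
derived series, so that no estimate on derivatives of Borel sums is needed. -/
theorem exists_contDiff_hasAsymptoticExpansion_deriv (C : ℕ → Mat m) :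
    ∃ F : ℝ → Mat m, ContDiff ℝ ∞ F ∧ HasAsymptoticExpansion F C ∧
      HasAsymptoticExpansion (deriv F) (derivCoeff C) := by
  have hGs := contDiff_borelSum (derivCoeff C)
  have hG := hasAsymptoticExpansion_borelSum (derivCoeff C)
  have hder : ∀ t, HasDerivAt (fun t => ∫ s in (0 : ℝ)..t, borelSum (derivCoeff C) s)
      (borelSum (derivCoeff C) t) t := fun t =>
    intervalIntegral.integral_hasDerivAt_right (hGs.continuous.intervalIntegrable _ _)
      hGs.continuous.stronglyMeasurable.stronglyMeasurableAtFilter hGs.continuous.continuousAt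
  have hG2 : borelSum (derivCoeff C) =O[atTop] fun t : ℝ => (t⁻¹) ^ (0 + 2) := by
    simpa [derivCoeff, Finset.sum_range_succ] using hG.isBigO_range 2
  obtain ⟨l, hl⟩ := exists_tendsto_of_deriv_isBigO (Eventually.of_forall hder) hG2
  have hder' : ∀ t, HasDerivAt
      (fun t => (∫ s in (0 : ℝ)..t, borelSum (derivCoeff C) s) + (C 0 - l))
      (borelSum (derivCoeff C) t) t := fun t => (hder t).add_const _
  have hderiv : deriv (fun t => (∫ s in (0 : ℝ)..t, borelSum (derivCoeff C) s) + (C 0 - l)) =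
      borelSum (derivCoeff C) := funext fun t => (hder' t).deriv
  refine ⟨_, contDiff_infty_iff_deriv.2 ⟨fun t => (hder' t).differentiableAt, ?_⟩, fun N => ?_, ?_⟩
  · exact (congrArg (ContDiff ℝ ∞) hderiv).mpr hGs
  · have hlim : Tendsto (fun t : ℝ => ∑ k ∈ Finset.range (N + 1), (t⁻¹) ^ k • C k) atTop
        (𝓝 (C 0)) := by
      simp only [Finset.sum_range_succ', pow_zero, one_smul]
      have := tendsto_finsetSum (Finset.range N) fun k _ =>
        (tendsto_inv_pow_succ k).smul_const (C (k + 1))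
      simpa using this.add_const (C 0)
    have hlim' : Tendsto (fun t : ℝ =>
        ((∫ s in (0 : ℝ)..t, borelSum (derivCoeff C) s) + (C 0 - l)) -
          ∑ k ∈ Finset.range (N + 1), (t⁻¹) ^ k • C k) atTop (𝓝 0) := by
      have h := (hl.add_const (C 0 - l)).sub hlim
      rw [add_sub_cancel, sub_self] at h
      exact h
    have := isBigO_sub_of_tendsto_of_deriv_isBigO (n := N) hlim'
      (by filter_upwards [eventually_ne_atTop 0] with t ht
          exact (hder' t).sub (hasDerivAt_sum_inv_pow_smul C N ht))
      (hG.isBigO_range (N + 2))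
    simpa only [sub_zero] using this
  · exact (congrArg (HasAsymptoticExpansion · (derivCoeff C)) hderiv).mpr hG

/-- Borel's lemma with values near the leading coefficient: away from infinity the function may be
replaced by the constant `C 0`. -/
theorem exists_contDiff_hasAsymptoticExpansion_deriv_mem (C : ℕ → Mat m) {U : Set (Mat m)}
    (hU : U ∈ 𝓝 (C 0)) :
    ∃ F : ℝ → Mat m, ContDiff ℝ ∞ F ∧ (∀ t, F t ∈ U) ∧ HasAsymptoticExpansion F C ∧
      HasAsymptoticExpansion (deriv F) (derivCoeff C) := by
  obtain ⟨F, hFs, hF, hF'⟩ := exists_contDiff_hasAsymptoticExpansion_deriv C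
  obtain ⟨ε, hε, hεU⟩ := Metric.mem_nhds_iff.1 hU
  obtain ⟨T, hT⟩ := eventually_atTop.1 (hF.tendsto.eventually (Metric.ball_mem_nhds (C 0) hε))
  let χ : ℝ → ℝ := fun t => Real.smoothTransition (t - T)
  have hχ : ContDiff ℝ ∞ χ := Real.smoothTransition.contDiff.comp (contDiff_id.sub contDiff_const)
  have heq : ∀ t, T + 1 ≤ t → F t = C 0 + χ t • (F t - C 0) := fun t ht => by
    rw [show χ t = 1 from Real.smoothTransition.one_of_one_le (by linarith), one_smul]; abel
  refine ⟨fun t => C 0 + χ t • (F t - C 0), contDiff_const.add (hχ.smul (hFs.sub contDiff_const)),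
    fun t => hεU ?_, ?_, ?_⟩
  · rw [mem_ball_iff_norm, add_sub_cancel_left, norm_smul,
      Real.norm_of_nonneg (Real.smoothTransition.nonneg _)]
    rcases le_total t T with h | h
    · rw [Real.smoothTransition.zero_of_nonpos (sub_nonpos.2 h), zero_mul]
      exact hε
    · refine (mul_le_of_le_one_left (norm_nonneg _) (Real.smoothTransition.le_one _)).trans_lt ?_
      exact mem_ball_iff_norm.1 (hT t h)
  · refine hF.congr' ?_
    filter_upwards [eventually_ge_atTop (T + 1)] with t ht using heq t ht
  · refine hF'.congr' ?_
    filter_upwards [eventually_gt_atTop (T + 1)] with t ht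
    refine EventuallyEq.deriv_eq ?_
    filter_upwards [eventually_gt_nhds ht] with s hs using heq s hs.le

end Borel

/-! ### Formal diagonalisation -/

section Formal

variable {m : ℕ}

/-- A nondegenerate matrix is diagonalisable. -/
theorem NonDegenerate.exists_mul_eq_mul_diagonal {B : Mat m} (hB : NonDegenerate B) :
    ∃ (μ : Fin m → ℂ) (P : Mat m), Function.Injective μ ∧ IsUnit P ∧
      B * P = P * Matrix.diagonal μ := by
  obtain ⟨μ, hμ, hev⟩ := hB
  choose v hv using fun i => (hev i).exists_hasEigenvector
  refine ⟨μ, Matrix.of fun i j => v j i, hμ, ?_, ?_⟩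
  · exact Matrix.linearIndependent_cols_iff_isUnit.1
      (Module.End.eigenvectors_linearIndependent' _ μ hμ v hv)
  · ext i j
    have := congrFun (hv j).apply_eq_smul i
    rw [Matrix.toLin'_apply, Pi.smul_apply, smul_eq_mul] at this
    rw [Matrix.mul_diagonal, Matrix.of_apply, mul_comm, ← this]
    rfl

/-- The homological equation: since the eigenvalues of `B` are distinct, the off-diagonal part of
any right-hand side can be removed by a commutator, and the diagonal part is absorbed by `L`. -/
theorem exists_homological_solution {B P : Mat m} {μ : Fin m → ℂ} (hμ : Function.Injective μ)
    (hP : IsUnit P) (hBP : B * P = P * Matrix.diagonal μ) (S : Mat m) :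
    ∃ XL : Mat m × Mat m, XL.2.IsDiag ∧
      S - B * XL.1 + XL.1 * Matrix.diagonal μ + P * XL.2 = 0 := by
  have hdet : IsUnit P.det := (Matrix.isUnit_iff_isUnit_det P).1 hP
  let S' : Mat m := P⁻¹ * S
  let Y : Mat m := Matrix.of fun i j => S' i j / (μ i - μ j)
  let L : Mat m := Matrix.diagonal fun i => -S' i i
  have hS : S = P * S' := by rw [← mul_assoc, Matrix.mul_nonsing_inv _ hdet, one_mul]
  have hY : S' - Matrix.diagonal μ * Y + Y * Matrix.diagonal μ + L = 0 := by
    ext i j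
    simp only [Matrix.add_apply, Matrix.sub_apply, Matrix.diagonal_mul, Matrix.mul_diagonal,
      Matrix.zero_apply, Y, L, Matrix.of_apply]
    rcases eq_or_ne i j with rfl | hij
    · rw [Matrix.diagonal_apply_eq]; ring
    · have : μ i - μ j ≠ 0 := sub_ne_zero.2 (hμ.ne hij)
      rw [Matrix.diagonal_apply_ne _ hij]
      field_simp
      ring
  refine ⟨(P * Y, L), Matrix.isDiag_diagonal _, ?_⟩
  calc S - B * (P * Y) + P * Y * Matrix.diagonal μ + P * L
      = P * (S' - Matrix.diagonal μ * Y + Y * Matrix.diagonal μ + L) := by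
        rw [← mul_assoc B, hBP, hS]; noncomm_ring
    _ = 0 := by rw [hY, mul_zero]

/-- A sequence may be defined by prescribing each term in terms of the preceding ones, these being
handed over as a sequence extended by zero. -/
theorem exists_seq_eq_truncation {α : Type*} [Zero α] (step : ℕ → (ℕ → α) → α) :
    ∃ f : ℕ → α, ∀ n, f n = step n fun k => if k < n then f k else 0 := by
  refine ⟨fun n => Nat.strongRec (motive := fun _ => α)
    (fun n ih => step n fun k => if h : k < n then ih k h else 0) n, fun n => ?_⟩
  beta_reduce
  rw [Nat.strongRec_eq]
  simp only [dite_eq_ite]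

/-- The operator `d/dt - A` can be diagonalised to all orders in `t⁻¹`: at the order `n ≥ 1` the
unknowns `M n` and `Λ n` enter through the homological equation only. -/
theorem exists_formal_diagonalisation (A : ℕ → Mat m) (hA : NonDegenerate (A 0)) :
    ∃ M Λ : ℕ → Mat m, IsUnit (M 0) ∧ (∀ n, (Λ n).IsDiag) ∧
      ∀ n, derivCoeff M n - ∑ p ∈ Finset.HasAntidiagonal.antidiagonal n, A p.1 * M p.2 +
        ∑ p ∈ Finset.HasAntidiagonal.antidiagonal n, M p.1 * Λ p.2 = 0 := by
  obtain ⟨μ, P, hμ, hP, hAP⟩ := hA.exists_mul_eq_mul_diagonal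
  choose sol hdiag hsol using exists_homological_solution hμ hP hAP
  let rhs : ℕ → (ℕ → Mat m × Mat m) → Mat m := fun n g =>
    derivCoeff (fun k => (g k).1) n -
      ∑ p ∈ Finset.HasAntidiagonal.antidiagonal n, A p.1 * (g p.2).1 +
      ∑ p ∈ Finset.HasAntidiagonal.antidiagonal n, (g p.1).1 * (g p.2).2
  obtain ⟨f, hf⟩ := exists_seq_eq_truncation (α := Mat m × Mat m) fun n g =>
    if n = 0 then (P, Matrix.diagonal μ) else sol (rhs n g)
  have hf0 : f 0 = (P, Matrix.diagonal μ) := by rw [hf, if_pos rfl]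
  refine ⟨fun n => (f n).1, fun n => (f n).2, ?_, fun n => ?_, fun n => ?_⟩
  · simpa only [hf0] using hP
  · beta_reduce
    rw [hf]
    split_ifs
    · exact Matrix.isDiag_diagonal _
    · exact hdiag _
  rcases Nat.eq_zero_or_pos n with rfl | hn
  · simp [derivCoeff, hf0, hAP]
  -- In the sums of products the truncated sequence `g` loses exactly the terms with index `n`.
  obtain ⟨g, hg⟩ : ∃ g : ℕ → Mat m × Mat m, g = fun k => if k < n then f k else 0 := ⟨_, rfl⟩
  have hlt : ∀ k, k < n → g k = f k := fun k hk => by simp [hg, hk]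
  have hge : g n = 0 := by simp [hg]
  have hfn : f n = sol (rhs n g) := by rw [hf, if_neg hn.ne', hg]
  have h1 : derivCoeff (fun k => (f k).1) n = derivCoeff (fun k => (g k).1) n := by
    simp only [derivCoeff, hlt (n - 1) (by omega)]
  have h2 : ∑ p ∈ Finset.HasAntidiagonal.antidiagonal n, A p.1 * (f p.2).1 =
      ∑ p ∈ Finset.HasAntidiagonal.antidiagonal n, A p.1 * (g p.2).1 + A 0 * (f n).1 := by
    have h : ∀ p ∈ Finset.HasAntidiagonal.antidiagonal n, A p.1 * (f p.2).1 =
        A p.1 * (g p.2).1 + if p = (0, n) then A 0 * (f n).1 else 0 := by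
      rintro ⟨i, j⟩ hp
      rw [Finset.HasAntidiagonal.mem_antidiagonal] at hp
      simp only [Prod.mk.injEq] at hp ⊢
      split_ifs with hij
      · rw [hij.1, hij.2, hge, Prod.fst_zero, mul_zero, zero_add]
      · rw [hlt j (by omega), add_zero]
    rw [Finset.sum_congr rfl h, Finset.sum_add_distrib, Finset.sum_ite_eq',
      if_pos (Finset.HasAntidiagonal.mem_antidiagonal.2 (zero_add n))]
  have h3 : ∑ p ∈ Finset.HasAntidiagonal.antidiagonal n, (f p.1).1 * (f p.2).2 =
      ∑ p ∈ Finset.HasAntidiagonal.antidiagonal n, (g p.1).1 * (g p.2).2 +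
        ((f n).1 * (f 0).2 + (f 0).1 * (f n).2) := by
    have h : ∀ p ∈ Finset.HasAntidiagonal.antidiagonal n, (f p.1).1 * (f p.2).2 =
        (g p.1).1 * (g p.2).2 + ((if p = (n, 0) then (f n).1 * (f 0).2 else 0) +
          if p = (0, n) then (f 0).1 * (f n).2 else 0) := by
      rintro ⟨i, j⟩ hp
      rw [Finset.HasAntidiagonal.mem_antidiagonal] at hp
      simp only [Prod.mk.injEq] at hp ⊢
      rcases Nat.eq_zero_or_pos i with rfl | hi
      · obtain rfl : j = n := by omega
        rw [hge, if_neg (by omega), if_pos ⟨rfl, rfl⟩, Prod.snd_zero, mul_zero, zero_add, zero_add]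
      · rcases Nat.eq_zero_or_pos j with rfl | hj
        · obtain rfl : i = n := by omega
          rw [hge, if_pos ⟨rfl, rfl⟩, if_neg (by omega), Prod.fst_zero, zero_mul, zero_add,
            add_zero]
        · rw [hlt i (by omega), hlt j (by omega), if_neg (by omega), if_neg (by omega), add_zero,
            add_zero]
    rw [Finset.sum_congr rfl h, Finset.sum_add_distrib, Finset.sum_add_distrib, Finset.sum_ite_eq',
      Finset.sum_ite_eq', if_pos (Finset.HasAntidiagonal.mem_antidiagonal.2 (add_zero n)),
      if_pos (Finset.HasAntidiagonal.mem_antidiagonal.2 (zero_add n))]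
  have key := hsol (rhs n g)
  rw [← hfn] at key
  rw [h1, h2, h3, hf0, ← key]
  simp only [rhs]
  abel

end Formal

theorem continuousAt_inv_matrix {m : ℕ} {X : Mat m} (hX : IsUnit X) :
    ContinuousAt (fun X : Mat m => X⁻¹) X := by
  obtain ⟨u, rfl⟩ := hX
  simp only [Matrix.nonsing_inv_eq_ringInverse]
  exact NormedRing.inverse_continuousAt u

/-- Existence of a diagonalisation: Borel summation of the formal one. -/
theorem exists_isDiagonalisation {m : ℕ} {A : ℝ → Mat m} {C : ℕ → Mat m}
    (hC : HasAsymptoticExpansion A C) (hnondeg : NonDegenerate (C 0)) :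
    ∃ M Λ : ℝ → Mat m, IsDiagonalisation A M Λ := by
  obtain ⟨Mc, Λc, hM0, hdiag, hrec⟩ := exists_formal_diagonalisation C hnondeg
  obtain ⟨M, hMs, hMU, hM, hM'⟩ := exists_contDiff_hasAsymptoticExpansion_deriv_mem Mc
    (U := {X | IsUnit X}) (Units.isOpen.mem_nhds hM0)
  have hΛ := hasAsymptoticExpansion_borelSum Λc
  refine ⟨M, borelSum Λc, hMs.contDiffOn, (contDiff_borelSum Λc).contDiffOn,
    exists_norm_le_of_continuousOn_of_tendsto hMs.continuous.continuousOn hM.tendsto,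
    fun t _ => hMU t,
    exists_norm_le_of_continuousOn_of_tendsto
      (fun t _ => ((continuousAt_inv_matrix (hMU t)).comp
        hMs.continuous.continuousAt).continuousWithinAt)
      ((continuousAt_inv_matrix hM0).tendsto.comp hM.tendsto),
    fun t _ => isDiag_borelSum hdiag t, ⟨_, hM⟩, ⟨_, hΛ⟩, ?_⟩
  have h := (hM'.sub (hC.mul hM)).add (hM.mul hΛ)
  simp only [hrec] at h
  exact h.rapidlyDecaying

/-! ### The leading coefficients of a diagonalisation -/

section Leading

variable {m : ℕ}

/-- The matrix entry at `(i, j)` as a continuous linear functional. -/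
noncomputable def entryCLM (i j : Fin m) : Mat m →L[ℝ] ℂ :=
  LinearMap.toContinuousLinearMap (Matrix.entryLinearMap ℝ ℂ i j)

/-- If both `f` and `f'` converge, then `f'` converges to zero. -/
theorem eq_zero_of_tendsto_of_tendsto_deriv {E : Type*} [NormedAddCommGroup E] [NormedSpace ℝ E]
    {f f' : ℝ → E} {a l : E} (hf : ∀ᶠ t in atTop, HasDerivAt f (f' t) t)
    (ha : Tendsto f atTop (𝓝 a)) (hl : Tendsto f' atTop (𝓝 l)) : l = 0 := by
  have h1 : Tendsto (fun t => f (t + 1) - f t) atTop (𝓝 0) := by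
    simpa using (ha.comp (tendsto_atTop_add_const_right atTop (1 : ℝ) tendsto_id)).sub ha
  refine tendsto_nhds_unique (f := fun t => f (t + 1) - f t) ?_ h1
  rw [tendsto_iff_norm_sub_tendsto_zero, Metric.tendsto_atTop]
  intro ε hε
  obtain ⟨T, hT⟩ := eventually_atTop.1
    (hf.and (hl.eventually (Metric.ball_mem_nhds l (half_pos hε))))
  refine ⟨T, fun t ht => ?_⟩
  have key := (convex_Icc t (t + 1)).norm_image_sub_le_of_norm_hasDerivWithin_le
    (f := fun x => f x - x • l) (f' := fun x => f' x - l) (C := ε / 2) (x := t) (y := t + 1)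
    (fun x hx => ((hT x (ht.trans hx.1)).1.sub
      (((hasDerivAt_id x).smul_const l).congr_deriv (one_smul _ _))).hasDerivWithinAt)
    (fun x hx => (mem_ball_iff_norm.1 (hT x (ht.trans hx.1)).2).le)
    ⟨le_rfl, by linarith⟩ ⟨by linarith, le_rfl⟩
  rw [dist_zero_right, norm_norm]
  have h2 : f (t + 1) - (t + 1) • l - (f t - t • l) = f (t + 1) - f t - l := by
    rw [add_smul, one_smul]; abel
  rw [h2, add_sub_cancel_left, norm_one, mul_one] at key
  linarith

/-- A limit of invertible matrices with bounded inverses is invertible. -/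
theorem isUnit_of_tendsto_of_inv_isBigO {X : ℝ → Mat m} {X₀ : Mat m}
    (hX : Tendsto X atTop (𝓝 X₀)) (hu : ∀ᶠ t in atTop, IsUnit (X t))
    (hb : (fun t => (X t)⁻¹) =O[atTop] fun _ => (1 : ℝ)) : IsUnit X₀ := by
  have h0 : Tendsto (fun t => (X t - X₀) * (X t)⁻¹) atTop (𝓝 0) := by
    have : (fun t => X t - X₀) =o[atTop] fun _ => (1 : ℝ) :=
      (isLittleO_one_iff ℝ).2 (tendsto_sub_nhds_zero_iff.2 hX)
    exact (isLittleO_one_iff ℝ).1 (by simpa using this.mul_isBigO hb)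
  have h1 : Tendsto (fun t => X₀ * (X t)⁻¹) atTop (𝓝 1) := by
    have h2 := (tendsto_const_nhds (x := (1 : Mat m))).sub h0
    rw [sub_zero] at h2
    refine h2.congr' ?_
    filter_upwards [hu] with t ht
    rw [sub_mul, Matrix.mul_nonsing_inv _ ((Matrix.isUnit_iff_isUnit_det _).1 ht), sub_sub_cancel]
  obtain ⟨t, ht⟩ := (h1.eventually (Units.isOpen.mem_nhds isUnit_one)).exists
  rw [Matrix.isUnit_iff_isUnit_det, Matrix.det_mul] at ht
  exact (Matrix.isUnit_iff_isUnit_det _).2 (isUnit_of_mul_isUnit_left ht)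

open scoped ComplexOrder in
/-- A diagonal matrix similar to a skew matrix has purely imaginary entries. -/
theorem re_apply_eq_zero_of_skew {B P L : Mat m} (hB : Bᴴ = -B) (hP : IsUnit P) (hL : L.IsDiag)
    (h : B * P = P * L) (i : Fin m) : (L i i).re = 0 := by
  have hpos : (Pᴴ * P).PosDef :=
    Matrix.PosDef.conjTranspose_mul_self _ (Matrix.mulVec_injective_of_isUnit hP)
  have hcomm : Lᴴ * (Pᴴ * P) = -(Pᴴ * P * L) := by
    rw [← mul_assoc, ← Matrix.conjTranspose_mul, ← h, Matrix.conjTranspose_mul, hB,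
      mul_assoc Pᴴ P L, ← h]
    noncomm_ring
  obtain ⟨d, rfl⟩ : ∃ d, Matrix.diagonal d = L := ⟨_, hL.diagonal_diag⟩
  have hii := congrFun (congrFun hcomm i) i
  rw [Matrix.diagonal_conjTranspose, Matrix.diagonal_mul, Matrix.neg_apply, Matrix.mul_diagonal,
    mul_comm, ← mul_neg] at hii
  have := congrArg Complex.re (mul_left_cancel₀ (hpos.diag_pos (i := i)).ne' hii)
  rw [Matrix.diagonal_apply_eq]
  simp at this
  linarith

variable {A M Λ : ℝ → Mat m}

theorem IsDiagonalisation.hasDerivAt (h : IsDiagonalisation A M Λ) {t : ℝ} (ht : 0 < t) :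
    HasDerivAt M (A t * M t - M t * Λ t + remainder A M Λ t) t := by
  have hd : DifferentiableAt ℝ M t :=
    (h.smooth_M.differentiableOn (by simp)).differentiableAt (Ici_mem_nhds ht)
  refine hd.hasDerivAt.congr_deriv ?_
  rw [remainder]
  abel

/-- The diagonal entries of `Λ` are imaginary up to `O(t⁻¹)`: the leading coefficient of `Λ` is
similar to that of `A`. -/
theorem IsDiagonalisation.re_isBigO (h : IsDiagonalisation A M Λ) {C : ℕ → Mat m}
    (hC : HasAsymptoticExpansion A C) (hskew : (C 0)ᴴ = -C 0) (i : Fin m) :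
    (fun t => (Λ t i i).re) =O[atTop] fun t : ℝ => t⁻¹ := by
  obtain ⟨Mc, hM⟩ := h.expansion_M
  obtain ⟨Λc, hΛ⟩ := h.expansion_Λ
  have hR : Tendsto (remainder A M Λ) atTop (𝓝 0) :=
    (h.rapidlyDecaying_remainder 1).trans_tendsto (tendsto_inv_pow_succ 0)
  have hlead := eq_zero_of_tendsto_of_tendsto_deriv
    (by filter_upwards [eventually_gt_atTop 0] with t ht using h.hasDerivAt ht) hM.tendsto
    (((hC.tendsto.mul hM.tendsto).sub (hM.tendsto.mul hΛ.tendsto)).add hR)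
  have hsim : C 0 * Mc 0 = Mc 0 * Λc 0 := sub_eq_zero.1 (by rwa [add_zero] at hlead)
  have hunit : IsUnit (Mc 0) := by
    obtain ⟨K, hK⟩ := h.bounded_inv_M
    refine isUnit_of_tendsto_of_inv_isBigO hM.tendsto
      (by filter_upwards [eventually_ge_atTop 0] with t ht using h.invertible_M t ht)
      (IsBigO.of_bound K ?_)
    filter_upwards [eventually_ge_atTop 0] with t ht
    rw [norm_one, mul_one]
    exact hK t ht
  have hdiag : (Λc 0).IsDiag := fun i j hij => by
    have h1 : Tendsto (fun t => Λ t i j) atTop (𝓝 (Λc 0 i j)) :=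
      ((entryCLM i j).continuous.tendsto (Λc 0)).comp hΛ.tendsto
    refine tendsto_nhds_unique h1 (tendsto_const_nhds.congr' ?_)
    filter_upwards [eventually_ge_atTop 0] with t ht
    exact (h.diagonal_Λ t ht hij).symm
  have hre := re_apply_eq_zero_of_skew hskew hunit hdiag hsim i
  refine IsBigO.trans (IsBigO.of_bound 1 (Eventually.of_forall fun t => ?_))
    (((entryCLM i i).isBigO_comp (fun t => Λ t - Λc 0) atTop).trans hΛ.isBigO_sub)
  have h2 : (Λ t i i).re = ((Λ t - Λc 0) i i).re := by
    rw [Matrix.sub_apply, Complex.sub_re, hre, sub_zero]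
  rw [one_mul, h2]
  exact Complex.abs_re_le_norm _

end Leading

/-! ### Polynomial growth and rapid decay -/

section Growth

variable {m : ℕ}

/-- The exponential of a function whose derivative has real part `O(t⁻¹)` grows at most
polynomially. -/
theorem exists_cexp_isBigO_pow {d δ : ℝ → ℂ} (hd : ∀ᶠ t in atTop, HasDerivAt d (δ t) t)
    (hδ : (fun t => (δ t).re) =O[atTop] fun t : ℝ => t⁻¹) :
    ∃ b : ℕ, (fun t => Complex.exp (d t)) =O[atTop] fun t : ℝ => t ^ b := by
  obtain ⟨K, hK⟩ := hδ.bound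
  obtain ⟨b, hb⟩ := exists_nat_ge K
  obtain ⟨T, hT⟩ := eventually_atTop.1 (hd.and (hK.and (eventually_gt_atTop 0)))
  refine ⟨b, IsBigO.of_bound (Real.exp ((d T).re - b * Real.log T)) ?_⟩
  have hder : ∀ t, T ≤ t → HasDerivAt (fun t => (d t).re - b * Real.log t)
      ((δ t).re - b * t⁻¹) t := fun t ht =>
    (Complex.reCLM.hasFDerivAt.comp_hasDerivAt t (hT t ht).1).sub
      ((Real.hasDerivAt_log (hT t ht).2.2.ne').const_mul _)
  have hanti : AntitoneOn (fun t => (d t).re - b * Real.log t) (Ici T) := by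
    refine antitoneOn_of_deriv_nonpos (convex_Ici T)
      (fun t ht => (hder t ht).continuousAt.continuousWithinAt)
      (fun t ht => (hder t (interior_subset ht)).differentiableAt.differentiableWithinAt)
      fun t ht => ?_
    have ht' : T ≤ t := interior_subset ht
    have ht0 : 0 < t := (hT t ht').2.2
    rw [(hder t ht').deriv, sub_nonpos]
    calc (δ t).re ≤ K * ‖t⁻¹‖ := (le_abs_self _).trans (hT t ht').2.1
      _ ≤ b * t⁻¹ := by
        rw [Real.norm_of_nonneg (by positivity)]
        gcongr
  filter_upwards [eventually_ge_atTop T] with t ht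
  have ht0 : 0 < t := (hT t ht).2.2
  rw [Complex.norm_exp, Real.norm_of_nonneg (by positivity), ← Real.exp_log ht0, ← Real.exp_nat_mul,
    ← Real.exp_add, Real.exp_le_exp, Real.exp_log ht0]
  have := hanti self_mem_Ici ht ht
  simp only at this
  linarith

theorem pow_isBigO_pow {a b : ℕ} (h : a ≤ b) :
    (fun t : ℝ => t ^ a) =O[atTop] fun t : ℝ => t ^ b := by
  refine IsBigO.of_bound 1 ?_
  filter_upwards [eventually_ge_atTop 1] with t ht
  rw [one_mul, Real.norm_of_nonneg (by positivity), Real.norm_of_nonneg (by positivity)]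
  exact pow_le_pow_right₀ ht h

theorem exists_diagonal_isBigO_pow {e : Fin m → ℝ → ℂ}
    (h : ∀ i, ∃ b : ℕ, e i =O[atTop] fun t : ℝ => t ^ b) :
    ∃ b : ℕ, (fun t => Matrix.diagonal fun i => e i t : ℝ → Mat m) =O[atTop]
      fun t : ℝ => t ^ b := by
  choose b hb using h
  refine ⟨Finset.univ.sup b, ?_⟩
  have h1 : (fun t i => e i t : ℝ → Fin m → ℂ) =O[atTop]
      fun t : ℝ => t ^ Finset.univ.sup b :=
    isBigO_pi.2 fun i => (hb i).trans (pow_isBigO_pow (Finset.le_sup (Finset.mem_univ i)))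
  refine IsBigO.trans (IsBigO.of_bound 1 (Eventually.of_forall fun t => ?_)) h1
  rw [one_mul, Matrix.linfty_opNorm_diagonal]

theorem pow_mul_inv_pow_eventuallyEq (b N : ℕ) :
    (fun t : ℝ => t ^ b * (t⁻¹) ^ (N + b)) =ᶠ[atTop] fun t => (t⁻¹) ^ N := by
  filter_upwards [eventually_ne_atTop 0] with t ht
  rw [pow_add, mul_left_comm, ← mul_pow, mul_inv_cancel₀ ht, one_pow, mul_one]

theorem RapidlyDecaying.mul_left {X G : ℝ → Mat m} (hX : RapidlyDecaying X) {b : ℕ}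
    (hG : G =O[atTop] fun t : ℝ => t ^ b) : RapidlyDecaying fun t => G t * X t := fun N =>
  (hG.mul (hX (N + b))).trans_eventuallyEq (pow_mul_inv_pow_eventuallyEq b N)

theorem RapidlyDecaying.mul_right {X G : ℝ → Mat m} (hX : RapidlyDecaying X) {b : ℕ}
    (hG : G =O[atTop] fun t : ℝ => t ^ b) : RapidlyDecaying fun t => X t * G t := fun N =>
  ((hX (N + b)).mul hG).trans_eventuallyEq
    ((EventuallyEq.of_eq (funext fun _ => mul_comm _ _)).trans (pow_mul_inv_pow_eventuallyEq b N))

end Growth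

/-! ### Propagators -/

section Propagators

variable {m : ℕ}

/-- The propagator of a diagonal system is diagonal, with the exponentials of the primitives of the
diagonal entries on the diagonal. -/
theorem exists_exp_integral_eq_diagonal {Λ : ℝ → Mat m} (hc : ContinuousOn Λ (Ici 0))
    (hdiag : ∀ t, 0 ≤ t → (Λ t).IsDiag) :
    ∃ d : Fin m → ℝ → ℂ, (∀ i, Continuous (d i)) ∧
      (∀ i t, 0 < t → HasDerivAt (d i) (Λ t i i) t) ∧
      ∀ t, 0 ≤ t → NormedSpace.exp (∫ s in (0 : ℝ)..t, Λ s) =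
        Matrix.diagonal fun i => Complex.exp (d i t) := by
  -- Extending `Λ` by its value at `0` makes it continuous on the whole line.
  have hΛ' : Continuous fun t => Λ (max t 0) :=
    hc.comp_continuous (by fun_prop) fun t => le_max_right t 0
  have hentry : ∀ i j, Continuous fun t => Λ (max t 0) i j := fun i j =>
    (entryCLM i j).continuous.comp hΛ'
  have hder : ∀ i t, HasDerivAt (fun t => ∫ s in (0 : ℝ)..t, Λ (max s 0) i i)
      (Λ (max t 0) i i) t := fun i t =>
    intervalIntegral.integral_hasDerivAt_right ((hentry i i).intervalIntegrable _ _)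
      (hentry i i).stronglyMeasurable.stronglyMeasurableAtFilter (hentry i i).continuousAt
  refine ⟨fun i t => ∫ s in (0 : ℝ)..t, Λ (max s 0) i i, fun i => ?_, fun i t ht => ?_,
    fun t ht => ?_⟩
  · exact continuous_iff_continuousAt.2 fun t => (hder i t).continuousAt
  · simpa [max_eq_left ht.le] using hder i t
  · have h1 : ∫ s in (0 : ℝ)..t, Λ s = ∫ s in (0 : ℝ)..t, Λ (max s 0) := by
      refine intervalIntegral.integral_congr fun s hs => ?_
      rw [uIcc_of_le ht] at hs
      simp only [max_eq_left hs.1]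
    have h2 : ∫ s in (0 : ℝ)..t, Λ (max s 0) =
        Matrix.diagonal fun i => ∫ s in (0 : ℝ)..t, Λ (max s 0) i i := by
      refine Matrix.ext fun i j => ((entryCLM i j).intervalIntegral_comp_comm
        (hΛ'.intervalIntegrable (μ := MeasureTheory.volume) 0 t)).symm.trans ?_
      change ∫ s in (0 : ℝ)..t, Λ (max s 0) i j = _
      rcases eq_or_ne i j with rfl | hij
      · rw [Matrix.diagonal_apply_eq]
      · rw [Matrix.diagonal_apply_ne _ hij]
        simp only [hdiag _ (le_max_right _ _) hij, intervalIntegral.integral_zero]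
    rw [h1, h2, Matrix.exp_diagonal, Complex.exp_eq_exp_ℂ]
    exact congrArg _ (Pi.exp_def _)

theorem hasDerivAt_diagonal {e e' : Fin m → ℝ → ℂ} {t : ℝ}
    (h : ∀ i, HasDerivAt (e i) (e' i t) t) :
    HasDerivAt (fun t => (Matrix.diagonal fun i => e i t : Mat m))
      (Matrix.diagonal fun i => e' i t) t := by
  let D : (Fin m → ℂ) →L[ℝ] Mat m :=
    LinearMap.toContinuousLinearMap (Matrix.diagonalLinearMap (Fin m) ℝ ℂ)
  exact D.hasFDerivAt.comp_hasDerivAt t (hasDerivAt_pi.2 h)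

theorem hasDerivAt_inv_matrix {Y : ℝ → Mat m} {Y' : Mat m} {t : ℝ} (hY : HasDerivAt Y Y' t)
    (hu : IsUnit (Y t)) : HasDerivAt (fun t => (Y t)⁻¹) (-((Y t)⁻¹ * Y' * (Y t)⁻¹)) t := by
  obtain ⟨u, hu⟩ := hu
  have h1 := hasFDerivAt_ringInverse (𝕜 := ℝ) u
  rw [hu] at h1
  simp only [Matrix.nonsing_inv_eq_ringInverse]
  refine (h1.comp_hasDerivAt t hY).congr_deriv ?_
  rw [← hu, Ring.inverse_unit]
  simp

/-- A system with continuous coefficients has a fundamental matrix `Φ`. Its inverse `Ψ` is found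
as the solution of the adjoint equation `Ψ' = -Ψ A`; with it, solutions of `v' = A v` on the
half-line are seen to be unique because `Ψ v` is constant. -/
theorem exists_fundamental_matrix {A : ℝ → Mat m} (hA : Continuous A) :
    ∃ Φ Ψ : ℝ → Mat m, (∀ t, HasDerivAt Φ (A t * Φ t) t) ∧
      (∀ t, HasDerivAt Ψ (-(Ψ t * A t)) t) ∧ (∀ t, Ψ t * Φ t = 1) ∧
      ∀ v₀ v, IsSolution A v₀ v → ∀ t, 0 ≤ t → v t = Φ t *ᵥ v₀ := by
  obtain ⟨Φ, hΦ0, hΦ⟩ := exists_hasDerivAt_linear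
    (L := fun t => ContinuousLinearMap.mul ℝ (Mat m) (A t))
    ((ContinuousLinearMap.mul ℝ (Mat m)).continuous.comp hA) 1
  obtain ⟨Ψ, hΨ0, hΨ⟩ := exists_hasDerivAt_linear
    (L := fun t => -((ContinuousLinearMap.mul ℝ (Mat m)).flip (A t)))
    ((ContinuousLinearMap.mul ℝ (Mat m)).flip.continuous.comp hA).neg 1
  have hΦ' : ∀ t, HasDerivAt Φ (A t * Φ t) t := hΦ
  have hΨ' : ∀ t, HasDerivAt Ψ (-(Ψ t * A t)) t := hΨ
  have hd : ∀ t, HasDerivAt (fun t => Ψ t * Φ t) 0 t := fun t =>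
    ((hΨ' t).mul (hΦ' t)).congr_deriv (by noncomm_ring)
  have hone : ∀ t, Ψ t * Φ t = 1 := fun t => by
    rw [is_const_of_deriv_eq_zero (fun t => (hd t).differentiableAt) (fun t => (hd t).deriv) t 0,
      hΨ0, hΦ0, one_mul]
  refine ⟨Φ, Ψ, hΦ', hΨ', hone, fun v₀ v hv t ht => ?_⟩
  have hw : ∀ s, 0 ≤ s → HasDerivWithinAt (fun s => Ψ s *ᵥ v s) 0 (Ici 0) s := by
    intro s hs
    rw [hasDerivWithinAt_pi]
    intro i
    have h1 : ∀ j, HasDerivWithinAt (fun s => Ψ s i j) ((-(Ψ s * A s)) i j) (Ici 0) s := fun j =>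
      ((entryCLM i j).hasFDerivAt.comp_hasDerivAt s (hΨ' s)).hasDerivWithinAt
    have h2 := HasDerivWithinAt.fun_sum (u := Finset.univ) fun j _ =>
      (h1 j).mul (hasDerivWithinAt_pi.1 (hv.2 s hs) j)
    refine h2.congr_deriv ?_
    have h3 : (-(Ψ s * A s)) *ᵥ v s + Ψ s *ᵥ (A s *ᵥ v s) = 0 := by
      rw [Matrix.neg_mulVec, Matrix.mulVec_mulVec, neg_add_cancel]
    have h4 := congrFun h3 i
    rw [Finset.sum_add_distrib]
    exact h4
  have hconst := constant_of_has_deriv_right_zero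
    (fun s hs => ((hw s hs.1).continuousWithinAt.mono Icc_subset_Ici_self))
    (fun s hs => (hw s hs.1).mono (Ici_subset_Ici.2 hs.1)) t ⟨ht, le_rfl⟩
  rw [hΨ0, Matrix.one_mulVec, hv.1] at hconst
  rw [← hconst, Matrix.mulVec_mulVec, mul_eq_one_comm.1 (hone t), Matrix.one_mulVec]

end Propagators

/-! ### Asymptotics of solutions -/

/-- In the frame `M exp(∫ Λ)` the equation `v' = A v` has the rapidly decaying coefficient
`-exp(-∫ Λ) M⁻¹ R exp(∫ Λ)`, with `R` the remainder. So its fundamental matrix `Q` converges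
rapidly. The proof works with `Y = Q⁻¹`, whose derivative involves no inverse. -/
theorem IsDiagonalisation.exists_representation {m : ℕ} {A M Λ : ℝ → Mat m}
    (h : IsDiagonalisation A M Λ) (hA : Continuous A) {C : ℕ → Mat m}
    (hC : HasAsymptoticExpansion A C) (hskew : (C 0)ᴴ = -C 0) :
    ∃ (Q : ℝ → Mat m) (Qinf : Mat m), (∃ K : ℝ, ∀ t : ℝ, 0 ≤ t → ‖Q t‖ ≤ K) ∧ IsUnit Qinf ∧
      RapidlyDecaying (fun t => Q t - Qinf) ∧
      ∀ v₀ v, IsSolution A v₀ v → ∀ t : ℝ, 0 ≤ t →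
        v t = (M t * NormedSpace.exp (∫ s in (0 : ℝ)..t, Λ s) * Q t * (M 0)⁻¹) *ᵥ v₀ := by
  obtain ⟨d, hdc, hdd, hexp⟩ :=
    exists_exp_integral_eq_diagonal h.smooth_Λ.continuousOn h.diagonal_Λ
  obtain ⟨Φ, Ψ, -, hΨ, hΨΦ, hsol⟩ := exists_fundamental_matrix hA
  let E : ℝ → Mat m := fun t => Matrix.diagonal fun i => Complex.exp (d i t)
  let E' : ℝ → Mat m := fun t => Matrix.diagonal fun i => Complex.exp (-d i t)
  have hEE' : ∀ t, E t * E' t = 1 := fun t => by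
    simp only [E, E', Matrix.diagonal_mul_diagonal, ← Complex.exp_add, add_neg_cancel,
      Complex.exp_zero, Matrix.diagonal_one]
  have hEu : ∀ t, IsUnit (E t) := fun t => IsUnit.of_mul_eq_one _ (hEE' t)
  have hΨu : ∀ t, IsUnit (Ψ t) := fun t => IsUnit.of_mul_eq_one _ (hΨΦ t)
  have hdet : ∀ {X : Mat m}, IsUnit X → IsUnit X.det := fun hX =>
    (Matrix.isUnit_iff_isUnit_det _).1 hX
  have hMu := h.invertible_M
  have hE : ∀ t, 0 < t → HasDerivAt E (Λ t * E t) t := fun t ht => by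
    refine (hasDerivAt_diagonal (e' := fun i t => Complex.exp (d i t) * Λ t i i)
      fun i => (hdd i t ht).cexp).congr_deriv ?_
    conv_rhs => rw [← (h.diagonal_Λ t ht.le).diagonal_diag, Matrix.diagonal_mul_diagonal]
    simp only [Matrix.diag_apply, mul_comm]
  have hEc : Continuous E := by
    have : Continuous fun t i => Complex.exp (d i t) :=
      continuous_pi fun i => Complex.continuous_exp.comp (hdc i)
    exact this.matrix_diagonal
  let Y : ℝ → Mat m := fun t => (M 0)⁻¹ * Ψ t * M t * E t
  let b : ℝ → Mat m := fun t => E' t * ((M t)⁻¹ * remainder A M Λ t * E t)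
  have hYu : ∀ t, 0 ≤ t → IsUnit (Y t) := fun t ht =>
    ((((Matrix.isUnit_nonsing_inv_iff.2 (hMu 0 le_rfl)).mul (hΨu t)).mul (hMu t ht)).mul (hEu t))
  have hY : ∀ t, 0 < t → HasDerivAt Y (Y t * b t) t := fun t ht => by
    refine ((((hΨ t).const_mul (M 0)⁻¹).mul (h.hasDerivAt ht)).mul (hE t ht)).congr_deriv ?_
    have h1 : Y t * b t = (M 0)⁻¹ * Ψ t * remainder A M Λ t * E t := by
      calc Y t * b t = (M 0)⁻¹ * Ψ t * M t * (E t * E' t) * (M t)⁻¹ * remainder A M Λ t * E t := by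
            simp only [Y, b]; noncomm_ring
        _ = (M 0)⁻¹ * Ψ t * (M t * (M t)⁻¹) * remainder A M Λ t * E t := by
            rw [hEE']; noncomm_ring
        _ = _ := by rw [Matrix.mul_nonsing_inv _ (hdet (hMu t ht.le)), mul_one]
    rw [h1, Pi.mul_apply]
    noncomm_ring
  have hpos : ∀ {p : ℝ → Prop}, (∀ t, 0 < t → p t) → ∀ᶠ t in atTop, p t := fun hp => by
    filter_upwards [eventually_gt_atTop 0] with t ht using hp t ht
  have hb : RapidlyDecaying b := by
    have hre := h.re_isBigO hC hskew
    obtain ⟨n, hn⟩ := exists_diagonal_isBigO_pow fun i =>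
      exists_cexp_isBigO_pow (hpos (hdd i)) (hre i)
    obtain ⟨n', hn'⟩ := exists_diagonal_isBigO_pow fun i =>
      exists_cexp_isBigO_pow (d := fun t => -d i t) (δ := fun t => -Λ t i i)
        (hpos fun t ht => (hdd i t ht).neg) (by simpa using (hre i).neg_left)
    have hMinv : (fun t => (M t)⁻¹) =O[atTop] fun t : ℝ => t ^ 0 := by
      obtain ⟨K, hK⟩ := h.bounded_inv_M
      refine IsBigO.of_bound K (hpos fun t ht => ?_)
      simpa using hK t ht.le
    exact ((h.rapidlyDecaying_remainder.mul_left hMinv).mul_right hn).mul_left hn'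
  have hQ : ∀ t, 0 < t → HasDerivAt (fun t => (Y t)⁻¹) (-(b t * (Y t)⁻¹)) t := fun t ht => by
    refine (hasDerivAt_inv_matrix (hY t ht) (hYu t ht.le)).congr_deriv ?_
    rw [← mul_assoc (Y t)⁻¹, Matrix.nonsing_inv_mul _ (hdet (hYu t ht.le)), one_mul]
  have hYb : Y =O[atTop] fun _ => (1 : ℝ) :=
    isBigO_one_of_norm_deriv_le (hpos hY) (hb 2).norm_left
      (Eventually.of_forall fun t => (norm_mul_le _ _).trans_eq (mul_comm _ _))
  have hQb : (fun t => (Y t)⁻¹) =O[atTop] fun _ => (1 : ℝ) :=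
    isBigO_one_of_norm_deriv_le (hpos hQ) (hb 2).norm_left
      (Eventually.of_forall fun t => (norm_neg _).trans_le (norm_mul_le _ _))
  have hQ' : ∀ N : ℕ, (fun t => -(b t * (Y t)⁻¹)) =O[atTop] fun t : ℝ => (t⁻¹) ^ N := fun N =>
    (hb.mul_right (b := 0) (by simpa using hQb) N).neg_left
  obtain ⟨Qinf, hlim⟩ := exists_tendsto_of_deriv_isBigO (n := 0) (hpos hQ) (hQ' 2)
  refine ⟨fun t => (Y t)⁻¹, Qinf, ?_, ?_, fun N => ?_, fun v₀ v hv t ht => ?_⟩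
  · refine exists_norm_le_of_continuousOn_of_tendsto (fun t ht => ?_) hlim
    have hYc : ContinuousWithinAt Y (Ici 0) t :=
      (((continuousWithinAt_const.mul (hΨ t).continuousAt.continuousWithinAt).mul
        (h.smooth_M.continuousOn t ht)).mul hEc.continuousWithinAt)
    exact (continuousAt_inv_matrix (hYu t ht)).comp_continuousWithinAt hYc
  · refine isUnit_of_tendsto_of_inv_isBigO hlim
      (hpos fun t ht => Matrix.isUnit_nonsing_inv_iff.2 (hYu t ht.le)) (hYb.congr' ?_ .rfl)
    exact hpos fun t ht => (Matrix.nonsing_inv_nonsing_inv _ (hdet (hYu t ht.le))).symm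
  · exact (isBigO_sub_of_tendsto_of_deriv_isBigO hlim (hpos hQ) (hQ' (N + 2))).trans
      (inv_pow_isBigO_inv_pow N.le_succ)
  · have hYt : M t * E t = Φ t * M 0 * Y t := by
      calc M t * E t = Φ t * Ψ t * (M t * E t) := by
            rw [mul_eq_one_comm.1 (hΨΦ t), one_mul]
        _ = Φ t * (M 0 * (M 0)⁻¹) * Ψ t * (M t * E t) := by
            rw [Matrix.mul_nonsing_inv _ (hdet (hMu 0 le_rfl)), mul_one]
        _ = _ := by simp only [Y]; noncomm_ring
    rw [hsol v₀ v hv t ht, hexp t ht, hYt, mul_assoc _ (Y t),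
      Matrix.mul_nonsing_inv _ (hdet (hYu t ht)), mul_one, mul_assoc,
      Matrix.mul_nonsing_inv _ (hdet (hMu 0 le_rfl)), mul_one]

end WKB

theorem mainTheorem12 (m : ℕ) (A : ℝ → WKB.Mat m) (hA : ContDiff ℝ ∞ A)
    (C : ℕ → WKB.Mat m) (hC : WKB.HasAsymptoticExpansion A C)
    (hA' : ∀ k : ℕ, ∃ D : ℕ → WKB.Mat m, WKB.HasAsymptoticExpansion (iteratedDeriv k A) D)
    (hnondeg : WKB.NonDegenerate (C 0)) (hskew : (C 0)ᴴ = -C 0) :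
    (∃ M Λ : ℝ → WKB.Mat m, WKB.IsDiagonalisation A M Λ) ∧
    ∀ M Λ : ℝ → WKB.Mat m, WKB.IsDiagonalisation A M Λ →
      ∃ (Q : ℝ → WKB.Mat m) (Qinf : WKB.Mat m),
        (∃ K : ℝ, ∀ t : ℝ, 0 ≤ t → ‖Q t‖ ≤ K) ∧
        IsUnit Qinf ∧
        WKB.RapidlyDecaying (fun t => Q t - Qinf) ∧
        ∀ (v₀ : Fin m → ℂ) (v : ℝ → Fin m → ℂ), WKB.IsSolution A v₀ v →
          ∀ t : ℝ, 0 ≤ t →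
            v t = (M t * NormedSpace.exp (∫ s in (0 : ℝ)..t, Λ s) * Q t * (M 0)⁻¹) *ᵥ v₀ :=
  ⟨WKB.exists_isDiagonalisation hC hnondeg, fun _ _ h =>
    h.exists_representation hA.continuous hC hskew⟩
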